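/- Formulas are built from propositional variables $p_i$ by $\wedge,\vee,\supset,\neg$. $\mathcal{H}\mathrm{Łuk}$ is the Hilbert-style system whose axioms are all instances of (1) $A\supset(B\supset A)$; (2) $(A\supset B)\supset((B\supset C)\supset(A\supset C))$; (3) $((A\supset B)\supset B)\supset((B\supset A)\supset A)$; (4) $((((A\supset B)\supset A)\supset A)\supset(B\supset C))\supset(B\supset C)$; (5) $(A\wedge B)\supset A$; (6) $(A\wedge B)\supset B$; (7) $(A\supset B)\supset((A\supset C)\supset(A\supset(B\wedge C)))$; (8) $A\supset(A\vee B)$; (9) $B\supset(A\vee B)$; (10) $(A\supset C)\supset((B\supset C)\supset((A\vee B)\supset C))$; (11) $(\neg B\supset\neg A)\supset(A\supset B)$. An $\mathcal{H}\mathrm{Łuk}$ proof of $A$ with $n$ steps is a sequence $A_1,\dots,A_n=A$ of formulas, each of which is an axiom or follows from two earlier ones by modus ponens (from $A$ and $A\supset B$ infer $B$). $\mathbf{ND}_{Ł_3}$ is the natural deduction calculus for three-valued Łukasiewicz logic whose derivations are trees of formulas. The leaves are labelled assumptions of arbitrary formulas and axioms $(A\vee\neg A)\vee((B\vee\neg B)\vee(A\supset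 B))$. The rules (premises $/$ conclusion) are: $A,\neg A/B$; $A,B/A\wedge B$; $A\wedge B/A$; $A\wedge B/B$; $A/A\vee B$; $B/A\vee B$; $A/\neg\neg A$, $\neg(A\vee B)/\neg A\wedge\neg B$ and $\neg(A\wedge B)/\neg A\vee\neg B$, each of these three in both directions; $\neg A\wedge\neg B/A\supset B$; $\neg A/(B\vee\neg B)\vee(A\supset B)$; $\neg A\wedge B/A\supset B$; $\neg B,(A\supset B)\vee\neg(A\supset B)/A\vee\neg A$; $B/(A\vee\neg A)\vee(A\supset B)$; $A\wedge\neg B/\neg(A\supset B)$; $A,(A\supset B)\vee\neg(A\supset B)/B\vee\neg B$; $A\wedge B/A\supset B$; and disjunction elimination: from derivations of $A\vee B$, of $C$ and of $C$ infer $C$, closing the assumptions $A$ with a chosen label $u$ in the second derivation and the assumptions $B$ with a chosen label $v$ in the third. A proof of $A$ is such a tree with root $A$ in which all assumptions are closed; its number of steps is its number of nodes. Let $\alpha(n)$ be the inverse Ackermann function, i.e. the least $i$ with $\mathrm{Ack}(i,i)>n$, where $\mathrm{Ack}(0,m)=2m$, $\mathrm{Ack}(k+1,0)=1$ and $\mathrm{Ack}(k+1,m+1)=\mathrm{Ack}(k,\mathrm{Ack}(k+1,m))$.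 Then there is a constant $c$ such that for every formula $A$: if $A$ has an $\mathbf{ND}_{Ł_3}$ proof with $n$ steps, then $A$ has an $\mathcal{H}\mathrm{Łuk}$ proof with at most $c\cdot n\cdot\alpha(n)$ steps. -/

import Mathlib

namespace Luk3

/-- Propositional formulas over `∧`, `∨`, `⊃`, `¬` with variables `p_0, p_1, …`. -/
inductive Formula : Type
  | var : ℕ → Formula
  | and : Formula → Formula → Formula
  | or : Formula → Formula → Formula
  | imp : Formula → Formula → Formula
  | not : Formula → Formula

/-- `IsHLukAx F`: the formula `F` is an instance of one of the eleven axiom schemas of the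
Hilbert-style (Frege) system HŁuk. -/
inductive IsHLukAx : Formula → Prop
  | ax1 (A B : Formula) : IsHLukAx (A.imp (B.imp A))
  | ax2 (A B C : Formula) : IsHLukAx ((A.imp B).imp ((B.imp C).imp (A.imp C)))
  | ax3 (A B : Formula) : IsHLukAx (((A.imp B).imp B).imp ((B.imp A).imp A))
  | ax4 (A B C : Formula) :
      IsHLukAx (((((A.imp B).imp A).imp A).imp (B.imp C)).imp (B.imp C))
  | ax5 (A B : Formula) : IsHLukAx ((A.and B).imp A)
  | ax6 (A B : Formula) : IsHLukAx ((A.and B).imp B)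
  | ax7 (A B C : Formula) : IsHLukAx ((A.imp B).imp ((A.imp C).imp (A.imp (B.and C))))
  | ax8 (A B : Formula) : IsHLukAx (A.imp (A.or B))
  | ax9 (A B : Formula) : IsHLukAx (B.imp (A.or B))
  | ax10 (A B C : Formula) : IsHLukAx ((A.imp C).imp ((B.imp C).imp ((A.or B).imp C)))
  | ax11 (A B : Formula) : IsHLukAx ((B.not.imp A.not).imp (A.imp B))

/-- The sequence `l` of formulas is an HŁuk derivation of `A` from `Γ`: its last member is `A`, and
each member is an axiom, belongs to `Γ`, or follows from two earlier members by modus ponens.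
The number of steps of the derivation is `l.length`. -/
def IsHLukDerivation (Γ : Set Formula) (l : List Formula) (A : Formula) : Prop :=
  l.getLast? = some A ∧
    ∀ i : Fin l.length,
      IsHLukAx (l.get i) ∨ l.get i ∈ Γ ∨
        ∃ j k : Fin l.length, j < i ∧ k < i ∧ l.get k = (l.get j).imp (l.get i)

/-- An HŁuk proof is a derivation from the empty set of formulas. -/
def IsHLukProof (l : List Formula) (A : Formula) : Prop :=
  IsHLukDerivation ∅ l A

/-- Proof trees of the natural deduction calculus ND_{Ł3}, indexed by the formula at the root.
Assumptions carry a label; `orE u v` closes the assumptions `A` labelled `u` in its second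
subtree and the assumptions `B` labelled `v` in its third subtree. -/
inductive NDTree : Formula → Type
  | assume (u : ℕ) (A : Formula) : NDTree A
  | ax (A B : Formula) : NDTree ((A.or A.not).or ((B.or B.not).or (A.imp B)))
  | efq {A : Formula} (B : Formula) : NDTree A → NDTree A.not → NDTree B
  | andI {A B : Formula} : NDTree A → NDTree B → NDTree (A.and B)
  | andE1 {A B : Formula} : NDTree (A.and B) → NDTree A
  | andE2 {A B : Formula} : NDTree (A.and B) → NDTree B
  | orI1 {A : Formula} (B : Formula) : NDTree A → NDTree (A.or B)
  | orI2 (A : Formula) {B : Formula} : NDTree B → NDTree (A.or B)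
  | orE (u v : ℕ) {A B C : Formula} : NDTree (A.or B) → NDTree C → NDTree C → NDTree C
  | dnI {A : Formula} : NDTree A → NDTree A.not.not
  | dnE {A : Formula} : NDTree A.not.not → NDTree A
  | deMOr {A B : Formula} : NDTree (A.or B).not → NDTree (A.not.and B.not)
  | deMOrInv {A B : Formula} : NDTree (A.not.and B.not) → NDTree (A.or B).not
  | deMAnd {A B : Formula} : NDTree (A.and B).not → NDTree (A.not.or B.not)
  | deMAndInv {A B : Formula} : NDTree (A.not.or B.not) → NDTree (A.and B).not
  | imp1 {A B : Formula} : NDTree (A.not.and B.not) → NDTree (A.imp B)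
  | imp2 {A : Formula} (B : Formula) : NDTree A.not → NDTree ((B.or B.not).or (A.imp B))
  | imp3 {A B : Formula} : NDTree (A.not.and B) → NDTree (A.imp B)
  | imp4 {A B : Formula} :
      NDTree B.not → NDTree ((A.imp B).or (A.imp B).not) → NDTree (A.or A.not)
  | imp5 (A : Formula) {B : Formula} : NDTree B → NDTree ((A.or A.not).or (A.imp B))
  | imp6 {A B : Formula} : NDTree (A.and B.not) → NDTree (A.imp B).not
  | imp7 {A B : Formula} :
      NDTree A → NDTree ((A.imp B).or (A.imp B).not) → NDTree (B.or B.not)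
  | imp8 {A B : Formula} : NDTree (A.and B) → NDTree (A.imp B)

namespace NDTree

/-- The set of open (labelled) assumptions of a proof tree. -/
def openAssumptions : {A : Formula} → NDTree A → Set (ℕ × Formula)
  | _, assume u A => {(u, A)}
  | _, ax _ _ => ∅
  | _, efq _ D₁ D₂ => D₁.openAssumptions ∪ D₂.openAssumptions
  | _, andI D₁ D₂ => D₁.openAssumptions ∪ D₂.openAssumptions
  | _, andE1 D => D.openAssumptions
  | _, andE2 D => D.openAssumptions
  | _, orI1 _ D => D.openAssumptions
  | _, orI2 _ D => D.openAssumptions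
  | _, orE (A := A) (B := B) u v D₁ D₂ D₃ =>
      D₁.openAssumptions ∪ (D₂.openAssumptions \ {(u, A)}) ∪ (D₃.openAssumptions \ {(v, B)})
  | _, dnI D => D.openAssumptions
  | _, dnE D => D.openAssumptions
  | _, deMOr D => D.openAssumptions
  | _, deMOrInv D => D.openAssumptions
  | _, deMAnd D => D.openAssumptions
  | _, deMAndInv D => D.openAssumptions
  | _, imp1 D => D.openAssumptions
  | _, imp2 _ D => D.openAssumptions
  | _, imp3 D => D.openAssumptions
  | _, imp4 D₁ D₂ => D₁.openAssumptions ∪ D₂.openAssumptions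
  | _, imp5 _ D => D.openAssumptions
  | _, imp6 D => D.openAssumptions
  | _, imp7 D₁ D₂ => D₁.openAssumptions ∪ D₂.openAssumptions
  | _, imp8 D => D.openAssumptions

/-- The number of steps of a proof tree: the number of its nodes (formula occurrences). -/
def steps : {A : Formula} → NDTree A → ℕ
  | _, assume _ _ => 1
  | _, ax _ _ => 1
  | _, efq _ D₁ D₂ => D₁.steps + D₂.steps + 1
  | _, andI D₁ D₂ => D₁.steps + D₂.steps + 1
  | _, andE1 D => D.steps + 1
  | _, andE2 D => D.steps + 1
  | _, orI1 _ D => D.steps + 1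
  | _, orI2 _ D => D.steps + 1
  | _, orE _ _ D₁ D₂ D₃ => D₁.steps + D₂.steps + D₃.steps + 1
  | _, dnI D => D.steps + 1
  | _, dnE D => D.steps + 1
  | _, deMOr D => D.steps + 1
  | _, deMOrInv D => D.steps + 1
  | _, deMAnd D => D.steps + 1
  | _, deMAndInv D => D.steps + 1
  | _, imp1 D => D.steps + 1
  | _, imp2 _ D => D.steps + 1
  | _, imp3 D => D.steps + 1
  | _, imp4 D₁ D₂ => D₁.steps + D₂.steps + 1
  | _, imp5 _ D => D.steps + 1
  | _, imp6 D => D.steps + 1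
  | _, imp7 D₁ D₂ => D₁.steps + D₂.steps + 1
  | _, imp8 D => D.steps + 1

/-- A proof tree is a proof of its root formula if all its assumptions are closed. -/
def IsProof {A : Formula} (D : NDTree A) : Prop :=
  D.openAssumptions = ∅

end NDTree

/-- The Ackermann function, normalised by `A(0, m) = 2m`, `A(k+1, 0) = 1`,
`A(k+1, m+1) = A(k, A(k+1, m))`. -/
def ackermann : ℕ → ℕ → ℕ
  | 0, m => 2 * m
  | _ + 1, 0 => 1
  | k + 1, m + 1 => ackermann k (ackermann (k + 1) m)

theorem lt_ackermann_succ (k m : ℕ) : m < ackermann (k + 1) m := by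
  induction k generalizing m with
  | zero =>
    induction m with
    | zero => simp [ackermann]
    | succ m ih => simp only [ackermann] at *; omega
  | succ k ihk =>
    induction m with
    | zero => simp [ackermann]
    | succ m ih =>
      have h := ihk (ackermann (k + 1 + 1) m)
      rw [ackermann]
      omega

theorem exists_lt_ackermann (n : ℕ) : ∃ i, n < ackermann i i :=
  ⟨n + 1, lt_trans (Nat.lt_succ_self n) (lt_ackermann_succ n (n + 1))⟩

/-- The inverse Ackermann function: the least `i` with `n < A(i, i)`. -/
def invAckermann (n : ℕ) : ℕ :=
  Nat.find (exists_lt_ackermann n)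

end Luk3

/-! Let `Γ` list the assumptions opened by disjunction eliminations between the root and a node that
concludes `A`, and let `G` be their conjunction. The node is translated into `G ⊃ (G ⊃ A)`. In
three-valued logic this formula is designated unless `G` is designated and `A` is not, so every
inference of natural deduction, including the discharge in disjunction elimination, becomes a
semantically valid schema. HŁuk is strongly complete (`Entails.provable`), and a derivation of a
schema can be substituted into. Hence each inference costs a number of steps that does not depend on
the formulas involved (`Entails.exists_costs`).

The exception is an assumption leaf. It extracts `A` from a nested conjunction whose depth may be
linear in the number `n` of nodes, and unpacking each one separately would give a quadratic bound.
Contexts are lists, and removing the head is the parent function of a tree with at most `n` nodes,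
whose edges are the implications between the conjunctions of a list and of its tail. Implications
compose at constant cost, so the problem is combinatorial: add few shortcuts to a tree so that every
ancestor of a node is reachable in few hops. By `exists_shortcuts`, `O(n α(n))` shortcuts allow
`O(α(n))` hops. The shortcuts are derived once and shared by all leaves, which gives `O(n α(n))` in
total (`NDTree.translates`).

Completeness uses Zorn's lemma: a theory maximal among those omitting `F` is prime, and axiom 4
leaves room for only one value besides true and false, so membership defines a three-valued
assignment refuting `F`. -/

namespace Luk3

/-! ### Counting derivation steps -/

/-- `Derives X n Y`: the set `Y` arises from `X` by adding `n` formulas, one after the other, each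
of which is an axiom or follows by modus ponens from formulas already present. -/
inductive Derives (X : Set Formula) : ℕ → Set Formula → Prop
  | refl : Derives X 0 X
  | ax {n : ℕ} {Y : Set Formula} {F : Formula} :
      Derives X n Y → IsHLukAx F → Derives X (n + 1) (insert F Y)
  | mp {n : ℕ} {Y : Set Formula} {F G : Formula} :
      Derives X n Y → G ∈ Y → G.imp F ∈ Y → Derives X (n + 1) (insert F Y)

namespace Derives

theorem subset {X Y : Set Formula} {n : ℕ} (h : Derives X n Y) : X ⊆ Y := by
  induction h with
  | refl => exact subset_rfl
  | ax _ _ ih => exact ih.trans (Set.subset_insert _ _)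
  | mp _ _ _ ih => exact ih.trans (Set.subset_insert _ _)

theorem union {X Y : Set Formula} {n : ℕ} (h : Derives X n Y) (Z : Set Formula) :
    Derives (X ∪ Z) n (Y ∪ Z) := by
  induction h with
  | refl => exact .refl
  | ax _ hF ih => rw [Set.insert_union]; exact ih.ax hF
  | mp _ h₁ h₂ ih => rw [Set.insert_union]; exact ih.mp (.inl h₁) (.inl h₂)

theorem trans {X Y Z : Set Formula} {n m : ℕ} (h : Derives X n Y) (h' : Derives Y m Z) :
    Derives X (n + m) Z := by
  induction h' with
  | refl => exact h
  | ax _ hF ih => exact ih.ax hF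
  | mp _ h₁ h₂ ih => exact ih.mp h₁ h₂

end Derives

/-- All members of `T` can be derived from `X` in a single derivation with at most `n` steps. -/
def Costs (X : Set Formula) (n : ℕ) (T : Set Formula) : Prop :=
  ∃ m ≤ n, ∃ Y, Derives X m Y ∧ T ⊆ Y

namespace Costs

variable {X X' T T' U : Set Formula} {n m : ℕ}

theorem of_subset (h : T ⊆ X) : Costs X 0 T :=
  ⟨0, le_rfl, X, .refl, h⟩

theorem mono (h : Costs X n T) (hX : X ⊆ X') (hn : n ≤ m) (hT : T' ⊆ T) : Costs X' m T' := by
  obtain ⟨k, hk, Y, hY, hTY⟩ := h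
  refine ⟨k, hk.trans hn, Y ∪ X', ?_, (hT.trans hTY).trans Set.subset_union_left⟩
  simpa [Set.union_eq_self_of_subset_left hX] using hY.union X'

/-- The first derivation is kept as a set of available formulas, so later derivations reuse `T`
without paying again. All sharing of shortcuts rests on this. -/
theorem trans (h : Costs X n T) (h' : Costs (X ∪ T) m U) : Costs X (n + m) (T ∪ U) := by
  obtain ⟨k, hk, Y, hY, hTY⟩ := h
  obtain ⟨k', hk', Z, hZ, hUZ⟩ := h'
  have hsub : X ∪ T ⊆ Y := Set.union_subset hY.subset hTY
  have h₂ := hZ.union Y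
  rw [Set.union_eq_self_of_subset_left hsub] at h₂
  exact ⟨k + k', by omega, Z ∪ Y, hY.trans h₂,
    Set.union_subset (hTY.trans Set.subset_union_right) (hUZ.trans Set.subset_union_left)⟩

theorem trans' (h : Costs X n T) (h' : Costs T m U) : Costs X (n + m) U :=
  (h.trans (h'.mono Set.subset_union_right le_rfl subset_rfl)).mono subset_rfl le_rfl
    Set.subset_union_right

theorem union (h : Costs X n T) (h' : Costs X m U) : Costs X (n + m) (T ∪ U) :=
  h.trans (h'.mono Set.subset_union_left le_rfl subset_rfl)

theorem biUnion {ι : Type*} {T : ι → Set Formula} (s : Finset ι)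
    (h : ∀ i ∈ s, Costs X n (T i)) : Costs X (n * s.card) (⋃ i ∈ s, T i) := by
  classical
  induction s using Finset.induction_on with
  | empty => exact of_subset (by simp)
  | insert a s ha ih =>
    rw [Finset.card_insert_of_notMem ha, Finset.set_biUnion_insert, Nat.mul_succ, add_comm]
    exact (h a (by simp)).union (ih fun i hi => h i (by simp [hi]))

end Costs

/-- A derivation without premises can be written as a list. -/
theorem Derives.exists_list {n : ℕ} {Y : Set Formula} (h : Derives ∅ n Y) :
    ∃ l : List Formula, l.length = n ∧ (∀ F, F ∈ Y ↔ F ∈ l) ∧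
      ∀ i : Fin l.length, IsHLukAx (l.get i) ∨
        ∃ j k : Fin l.length, j < i ∧ k < i ∧ l.get k = (l.get j).imp (l.get i) := by
  have key : ∀ (l : List Formula) (F : Formula),
      (∀ i : Fin l.length, IsHLukAx (l.get i) ∨
        ∃ j k : Fin l.length, j < i ∧ k < i ∧ l.get k = (l.get j).imp (l.get i)) →
      (IsHLukAx F ∨ ∃ G ∈ l, G.imp F ∈ l) →
      ∀ i : Fin (l ++ [F]).length, IsHLukAx ((l ++ [F]).get i) ∨
        ∃ j k : Fin (l ++ [F]).length, j < i ∧ k < i ∧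
          (l ++ [F]).get k = ((l ++ [F]).get j).imp ((l ++ [F]).get i) := by
    intro l F hl hF ⟨i, hi⟩
    have hlen : (l ++ [F]).length = l.length + 1 := by simp
    rcases Nat.lt_or_ge i l.length with h | h
    · rcases hl ⟨i, h⟩ with h' | ⟨⟨j, hj⟩, ⟨k, hk⟩, hji, hki, e⟩
      · left
        simpa [List.getElem_append_left h] using h'
      · right
        refine ⟨⟨j, by omega⟩, ⟨k, by omega⟩, hji, hki, ?_⟩
        simpa [List.getElem_append_left h, List.getElem_append_left hj,
          List.getElem_append_left hk] using e
    · obtain rfl : i = l.length := by omega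
      rcases hF with h' | ⟨G, hG, hGF⟩
      · left
        simpa using h'
      · right
        obtain ⟨j, hj, rfl⟩ := List.getElem_of_mem hG
        obtain ⟨k, hk, e⟩ := List.getElem_of_mem hGF
        refine ⟨⟨j, by omega⟩, ⟨k, by omega⟩, hj, hk, ?_⟩
        simpa [List.getElem_append_left hj, List.getElem_append_left hk] using e
  induction h with
  | refl => exact ⟨[], rfl, by simp, fun i => i.elim0⟩
  | @ax n Y F _ hF ih =>
    obtain ⟨l, hn, hY, hl⟩ := ih
    refine ⟨l ++ [F], by simp [hn], fun G => ?_, key l F hl (.inl hF)⟩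
    simp [hY, or_comm]
  | @mp n Y F G _ h₁ h₂ ih =>
    obtain ⟨l, hn, hY, hl⟩ := ih
    refine ⟨l ++ [F], by simp [hn], fun G => ?_,
      key l F hl (.inr ⟨G, (hY _).1 h₁, (hY _).1 h₂⟩)⟩
    simp [hY, or_comm]

/-- The list need not end in `A`. Cutting it after an occurrence of `A` is harmless because
justifications only point backwards. -/
theorem Costs.exists_proof {n : ℕ} {A : Formula} (h : Costs ∅ n {A}) :
    ∃ l, IsHLukProof l A ∧ l.length ≤ n := by
  obtain ⟨m, hm, Y, hY, hA⟩ := h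
  obtain ⟨l, hl, hYl, hv⟩ := hY.exists_list
  obtain ⟨i, hi, e⟩ := List.getElem_of_mem ((hYl A).1 (hA rfl))
  have hlen : (l.take (i + 1)).length = i + 1 := by simp; omega
  refine ⟨l.take (i + 1), ⟨?_, ?_⟩, by omega⟩
  · rw [List.getLast?_eq_getElem?, hlen]
    simp [e, hi]
  · intro ⟨t, ht⟩
    rw [hlen] at ht
    rcases hv ⟨t, by omega⟩ with h' | ⟨⟨j, hj⟩, ⟨k, hk⟩, hji, hki, heq⟩
    · left
      simpa using h'
    · right; right
      have hj' : j < t := hji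
      have hk' : k < t := hki
      exact ⟨⟨j, by omega⟩, ⟨k, by omega⟩, hji, hki, by simpa using heq⟩

/-! ### Substitution -/

/-- Simultaneous substitution of formulas for variables. -/
def Formula.subst (σ : ℕ → Formula) : Formula → Formula
  | .var n => σ n
  | .and A B => .and (A.subst σ) (B.subst σ)
  | .or A B => .or (A.subst σ) (B.subst σ)
  | .imp A B => .imp (A.subst σ) (B.subst σ)
  | .not A => .not (A.subst σ)

theorem IsHLukAx.subst {F : Formula} (h : IsHLukAx F) (σ : ℕ → Formula) :
    IsHLukAx (F.subst σ) := by
  cases h <;> simp only [Formula.subst] <;> constructor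

theorem Derives.subst {X Y : Set Formula} {n : ℕ} (h : Derives X n Y) (σ : ℕ → Formula) :
    Derives (Formula.subst σ '' X) n (Formula.subst σ '' Y) := by
  induction h with
  | refl => exact .refl
  | ax _ hF ih => rw [Set.image_insert_eq]; exact ih.ax (hF.subst σ)
  | mp _ h₁ h₂ ih =>
    rw [Set.image_insert_eq]
    exact ih.mp (Set.mem_image_of_mem _ h₁) (Set.mem_image_of_mem _ h₂)

/-! ### Completeness of HŁuk for the three-valued semantics -/

/-- The three-valued Łukasiewicz implication, with truth values `0 < 1 < 2`. -/
def impVal (a b : Fin 3) : Fin 3 := if a ≤ b then 2 else 2 - a + b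

/-- The value of a formula under a three-valued assignment; the designated value is `2`. -/
def Formula.eval (v : ℕ → Fin 3) : Formula → Fin 3
  | .var n => v n
  | .and A B => min (A.eval v) (B.eval v)
  | .or A B => max (A.eval v) (B.eval v)
  | .imp A B => impVal (A.eval v) (B.eval v)
  | .not A => 2 - A.eval v

/-- A theory: a set of formulas that contains the axioms and is closed under modus ponens. -/
structure IsTheory (T : Set Formula) : Prop where
  ax : ∀ {F}, IsHLukAx F → F ∈ T
  mp : ∀ {F G : Formula}, F.imp G ∈ T → F ∈ T → G ∈ T

namespace IsTheory

variable {T : Set Formula} {A B C : Formula}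

theorem weaken (hT : IsTheory T) (h : A ∈ T) (B : Formula) : B.imp A ∈ T :=
  hT.mp (hT.ax (.ax1 A B)) h

theorem comp (hT : IsTheory T) (h : A.imp B ∈ T) (h' : B.imp C ∈ T) : A.imp C ∈ T :=
  hT.mp (hT.mp (hT.ax (.ax2 A B C)) h) h'

/-- Axiom 1 gives `A ⊃ ((B ⊃ A) ⊃ A)`, and axiom 3 swaps the roles of `A` and `B`. Exchange follows
from this; contraction is not valid in this logic. -/
theorem assertion (hT : IsTheory T) (A B : Formula) : A.imp ((A.imp B).imp B) ∈ T :=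
  hT.comp (hT.ax (.ax1 A (B.imp A))) (hT.ax (.ax3 B A))

theorem exchange (hT : IsTheory T) (h : A.imp (B.imp C) ∈ T) : B.imp (A.imp C) ∈ T :=
  hT.comp (hT.assertion B C) (hT.mp (hT.ax (.ax2 A (B.imp C) C)) h)

theorem refl (hT : IsTheory T) (A : Formula) : A.imp A ∈ T :=
  hT.mp (hT.exchange (hT.ax (.ax1 A (A.imp (A.imp A))))) (hT.ax (.ax1 A A))

theorem imp_left (hT : IsTheory T) (h : A.imp B ∈ T) (C : Formula) : (B.imp C).imp (A.imp C) ∈ T :=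
  hT.mp (hT.ax (.ax2 A B C)) h

theorem imp_right (hT : IsTheory T) (h : A.imp B ∈ T) (C : Formula) : (C.imp A).imp (C.imp B) ∈ T :=
  hT.mp (hT.exchange (hT.ax (.ax2 C A B))) h

theorem efq (hT : IsTheory T) (A B : Formula) : A.not.imp (A.imp B) ∈ T :=
  hT.comp (hT.ax (.ax1 A.not B.not)) (hT.ax (.ax11 A B))

/-- Ex falso is aimed at `¬(A ⊃ A)`, so that axiom 11 returns `(A ⊃ A) ⊃ A`, whose premise is
provable. -/
theorem not_not_imp (hT : IsTheory T) (A : Formula) : A.not.not.imp A ∈ T :=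
  hT.mp (hT.exchange (hT.comp (hT.efq A.not (A.imp A).not) (hT.ax (.ax11 (A.imp A) A))))
    (hT.refl A)

theorem imp_not_not (hT : IsTheory T) (A : Formula) : A.imp A.not.not ∈ T :=
  hT.mp (hT.ax (.ax11 A A.not.not)) (hT.not_not_imp A.not)

theorem contrapose (hT : IsTheory T) (h : A.imp B ∈ T) : B.not.imp A.not ∈ T :=
  hT.mp (hT.ax (.ax11 B.not A.not))
    (hT.comp (hT.comp (hT.not_not_imp A) h) (hT.imp_not_not B))

theorem or_elim (hT : IsTheory T) (h : A.imp C ∈ T) (h' : B.imp C ∈ T) : (A.or B).imp C ∈ T :=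
  hT.mp (hT.mp (hT.ax (.ax10 A B C)) h) h'

theorem and_intro (hT : IsTheory T) (hA : C.imp A ∈ T) (hB : C.imp B ∈ T) :
    C.imp (A.and B) ∈ T :=
  hT.mp (hT.mp (hT.ax (.ax7 C A B)) hA) hB

/-- In a commutative BCK-algebra `(A ⊃ B) ⊃ B` is the join of `A` and `B`. -/
theorem imp_imp_or (hT : IsTheory T) (A B : Formula) : ((A.imp B).imp B).imp (A.or B) ∈ T := by
  have h₁ : ((A.imp B).imp B).imp (((A.or B).imp B).imp B) ∈ T :=
    hT.imp_left (hT.imp_left (hT.ax (.ax8 A B)) B) B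
  have h₂ : ((B.imp (A.or B)).imp (A.or B)).imp (A.or B) ∈ T :=
    hT.mp (hT.assertion _ _) (hT.ax (.ax9 A B))
  exact hT.comp h₁ (hT.comp (hT.ax (.ax3 _ _)) h₂)

theorem or_imp_or (hT : IsTheory T) (U A B : Formula) : (A.imp B).imp ((U.or A).imp (U.or B)) ∈ T :=
  hT.comp (hT.imp_right (hT.ax (.ax9 U B)) A)
    (hT.mp (hT.ax (.ax10 U A (U.or B))) (hT.ax (.ax8 U B)))

theorem or_comm_mem (hT : IsTheory T) (h : A.or B ∈ T) : B.or A ∈ T :=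
  hT.mp (hT.or_elim (hT.ax (.ax9 B A)) (hT.ax (.ax8 B A))) h

/-- The formulas whose disjunction with `U` belongs to a theory form a theory. -/
theorem or_theory (hT : IsTheory T) (U : Formula) : IsTheory {A | U.or A ∈ T} where
  ax h := hT.mp (hT.ax (.ax9 _ _)) (hT.ax h)
  mp {F G} hFG hF := by
    have h₁ : U.imp ((U.or F).imp (U.or G)) ∈ T :=
      hT.comp (hT.ax (.ax8 U G)) (hT.ax (.ax1 _ _))
    exact hT.mp (hT.mp (hT.or_elim h₁ (hT.or_imp_or U F G)) hFG) hF

/-- The schema that singles out the three-valued logic among the Łukasiewicz logics. -/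
theorem or_imp_or_not (hT : IsTheory T) (A B : Formula) : (A.or (A.imp B)).or B.not ∈ T := by
  -- Axiom 4 has the form `(X ⊃ Y) ⊃ Y` and so yields `X ∨ Y`. Axiom 3 brings `X` to the form of a
  -- join of `A` and `A ⊃ B`; the refutable choice `C = ¬(A ⊃ A)` makes `Y = (B ⊃ C)` imply `¬B`.
  have h₁ := hT.mp (hT.imp_imp_or _ _)
    (hT.ax (.ax4 A B (A.imp A).not))
  have h₂ : (((A.imp B).imp A).imp A).imp (A.or (A.imp B)) ∈ T :=
    hT.comp (hT.ax (.ax3 _ _)) (hT.imp_imp_or _ _)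
  have h₃ : (B.imp (A.imp A).not).imp B.not ∈ T :=
    hT.comp (hT.imp_left (hT.not_not_imp B) _)
      (hT.mp (hT.exchange (hT.ax (.ax11 (A.imp A) B.not))) (hT.refl A))
  exact hT.mp (hT.or_elim (hT.comp h₂ (hT.ax (.ax8 _ _))) (hT.comp h₃ (hT.ax (.ax9 _ _)))) h₁

end IsTheory

/-- The theory generated by a set of formulas. -/
inductive Provable (X : Set Formula) : Formula → Prop
  | hyp {F : Formula} : F ∈ X → Provable X F
  | ax {F : Formula} : IsHLukAx F → Provable X F
  | mp {F G : Formula} : Provable X (F.imp G) → Provable X F → Provable X G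

theorem isTheory_provable (X : Set Formula) : IsTheory {F | Provable X F} :=
  ⟨.ax, .mp⟩

theorem Provable.exists_costs {X : Set Formula} {F : Formula} (h : Provable X F) :
    ∃ n, Costs X n {F} := by
  induction h with
  | hyp h => exact ⟨0, .of_subset (by simpa using h)⟩
  | ax h => exact ⟨1, 1, le_rfl, _, Derives.refl.ax h, by simp⟩
  | @mp F G _ _ ih₁ ih₂ =>
    obtain ⟨n, h₁⟩ := ih₁
    obtain ⟨m, h₂⟩ := ih₂
    refine ⟨n + m + 1, (h₁.union h₂).trans' ⟨1, le_rfl, _,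
      Derives.refl.mp (F := G) (G := F) ?_ ?_, ?_⟩⟩ <;> simp

/-- A theory that is maximal among those that omit `F` is prime. -/
theorem IsTheory.prime {T : Set Formula} (hT : IsTheory T) {F : Formula} (hF : F ∉ T)
    (hmax : ∀ T', IsTheory T' → F ∉ T' → T ⊆ T' → T' ⊆ T) {U V : Formula} (h : U.or V ∈ T) :
    U ∈ T ∨ V ∈ T := by
  by_contra! hc
  have hsub : ∀ U : Formula, T ⊆ {A | U.or A ∈ T} := fun U A hA => hT.mp (hT.ax (.ax9 _ _)) hA
  -- Maximality is applied twice: to the theory of all `A` with `U ∨ A ∈ T`, which contains `V`, and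
  -- then to that of all `A` with `F ∨ A ∈ T`, which contains `U`. The second must contain `F`, so
  -- `F ∨ F ∈ T`.
  have h₁ : U.or F ∈ T := by
    by_contra hn
    exact hc.2 (hmax _ (hT.or_theory U) hn (hsub U) h)
  refine hc.1 (hmax _ (hT.or_theory F) (fun hn => hF ?_) (hsub F) (hT.or_comm_mem h₁))
  exact hT.mp (hT.or_elim (hT.refl F) (hT.refl F)) hn

/-- The value a theory assigns to a formula. -/
noncomputable def theoryVal (T : Set Formula) (A : Formula) : Fin 3 :=
  open Classical in if A ∈ T then 2 else if A.not ∈ T then 0 else 1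

/-- A consistent prime theory is given by a three-valued assignment. -/
theorem IsTheory.eval_theoryVal {T : Set Formula} (hT : IsTheory T) {F : Formula} (hF : F ∉ T)
    (hprime : ∀ {U V : Formula}, U.or V ∈ T → U ∈ T ∨ V ∈ T) (A : Formula) :
    A.eval (fun n => theoryVal T (.var n)) = theoryVal T A := by
  have hcons : ∀ A : Formula, A ∈ T → A.not ∉ T := fun A h h' =>
    hF (hT.mp (hT.mp (hT.efq A F) h') h)
  induction A with
  | var n => rfl
  | and A B ihA ihB =>
    have h₁ : A.and B ∈ T ↔ A ∈ T ∧ B ∈ T :=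
      ⟨fun h => ⟨hT.mp (hT.ax (.ax5 _ _)) h, hT.mp (hT.ax (.ax6 _ _)) h⟩, fun h =>
        hT.mp (hT.and_intro (hT.refl A) (hT.weaken h.2 A)) h.1⟩
    have h₂ : (A.and B).not ∈ T ↔ A.not ∈ T ∨ B.not ∈ T := by
      constructor
      · intro h
        apply hprime
        refine hT.mp (hT.comp (hT.contrapose (hT.and_intro ?_ ?_)) (hT.not_not_imp _)) h
        · exact hT.comp (hT.contrapose (hT.ax (.ax8 A.not B.not))) (hT.not_not_imp A)
        · exact hT.comp (hT.contrapose (hT.ax (.ax9 A.not B.not))) (hT.not_not_imp B)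
      · rintro (h | h)
        · exact hT.mp (hT.contrapose (hT.ax (.ax5 _ _))) h
        · exact hT.mp (hT.contrapose (hT.ax (.ax6 _ _))) h
    have := hcons A
    have := hcons B
    rw [Formula.eval, ihA, ihB]
    simp only [theoryVal, h₁, h₂]
    by_cases hA : A ∈ T <;> by_cases hB : B ∈ T <;> by_cases hA' : A.not ∈ T <;>
      by_cases hB' : B.not ∈ T <;> simp_all
  | or A B ihA ihB =>
    have h₁ : A.or B ∈ T ↔ A ∈ T ∨ B ∈ T :=
      ⟨hprime, fun h => h.elim (hT.mp (hT.ax (.ax8 _ _))) (hT.mp (hT.ax (.ax9 _ _)))⟩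
    have h₂ : (A.or B).not ∈ T ↔ A.not ∈ T ∧ B.not ∈ T := by
      constructor
      · exact fun h => ⟨hT.mp (hT.contrapose (hT.ax (.ax8 _ _))) h,
          hT.mp (hT.contrapose (hT.ax (.ax9 _ _))) h⟩
      · rintro ⟨h, h'⟩
        have hA : A.imp (A.imp A).not ∈ T := hT.mp (hT.efq _ _) h
        have hB : B.imp (A.imp A).not ∈ T := hT.mp (hT.efq _ _) h'
        exact hT.mp (hT.contrapose (hT.or_elim hA hB)) (hT.mp (hT.imp_not_not _) (hT.refl A))
    have := hcons A
    have := hcons B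
    rw [Formula.eval, ihA, ihB]
    simp only [theoryVal, h₁, h₂]
    by_cases hA : A ∈ T <;> by_cases hB : B ∈ T <;> by_cases hA' : A.not ∈ T <;>
      by_cases hB' : B.not ∈ T <;> simp_all
  | imp A B ihA ihB =>
    have h₁ : (A.imp B).not ∈ T ↔ A ∈ T ∧ B.not ∈ T := by
      refine ⟨fun h => ⟨?_, hT.mp (hT.contrapose (hT.ax (.ax1 _ _))) h⟩, fun h => ?_⟩
      · exact hT.mp (hT.comp (hT.contrapose (hT.efq A B)) (hT.not_not_imp A)) h
      · exact hT.mp (hT.contrapose (hT.mp (hT.assertion A B) h.1)) h.2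
    have h₂ : A.not ∈ T → A.imp B ∈ T := hT.mp (hT.efq A B)
    have h₃ : B ∈ T → A.imp B ∈ T := fun h => hT.weaken h A
    -- This settles the case in which `A` and `B` both have the middle value: `A ⊃ B` must then
    -- belong to `T`. It is where axiom 4 enters.
    have h₄ : A ∈ T ∨ A.imp B ∈ T ∨ B.not ∈ T := by
      rcases hprime (hT.or_imp_or_not A B) with h | h
      · exact (hprime h).imp_right .inl
      · exact .inr (.inr h)
    have h₅ : A.imp B ∈ T → A ∈ T → B ∈ T := hT.mp
    have h₆ : A.imp B ∈ T → B.not ∈ T → A.not ∈ T := fun h => hT.mp (hT.contrapose h)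
    have := hcons A
    have := hcons B
    rw [Formula.eval, ihA, ihB]
    simp only [theoryVal, h₁]
    by_cases hA : A ∈ T <;> by_cases hB : B ∈ T <;> by_cases hA' : A.not ∈ T <;>
      by_cases hB' : B.not ∈ T <;> by_cases hAB : A.imp B ∈ T <;> simp_all [impVal]
  | not A ih =>
    have h₁ : A.not.not ∈ T ↔ A ∈ T := ⟨hT.mp (hT.not_not_imp A), hT.mp (hT.imp_not_not A)⟩
    have := hcons A
    rw [Formula.eval, ih]
    simp only [theoryVal, h₁]
    by_cases hA : A ∈ T <;> by_cases hA' : A.not ∈ T <;> simp_all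

/-- `F` is a three-valued semantic consequence of `X`. -/
def Entails (X : Set Formula) (F : Formula) : Prop :=
  ∀ v : ℕ → Fin 3, (∀ G ∈ X, G.eval v = 2) → F.eval v = 2

/-- Strong completeness of HŁuk. -/
theorem Entails.provable {X : Set Formula} {F : Formula} (h : Entails X F) : Provable X F := by
  by_contra hF
  obtain ⟨T, hXT, hT⟩ := zorn_subset_nonempty {T | IsTheory T ∧ F ∉ T} (fun c hc hchain hne => by
    refine ⟨⋃₀ c, ⟨⟨fun hA => ?_, fun {A B} hA hB => ?_⟩, ?_⟩, fun s hs =>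
      Set.subset_sUnion_of_mem hs⟩
    · obtain ⟨s, hs⟩ := hne
      exact ⟨s, hs, (hc hs).1.ax hA⟩
    · obtain ⟨s, hs, hA⟩ := hA
      obtain ⟨t, ht, hB⟩ := hB
      rcases hchain.total hs ht with hst | hts
      · exact ⟨t, ht, (hc ht).1.mp (hst hA) hB⟩
      · exact ⟨s, hs, (hc hs).1.mp hA (hts hB)⟩
    · rintro ⟨s, hs, hFs⟩
      exact (hc hs).2 hFs) {G | Provable X G} ⟨isTheory_provable X, hF⟩
  obtain ⟨⟨hth, hFT⟩, hmax⟩ := hT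
  have heval := hth.eval_theoryVal hFT
    (hth.prime hFT fun T' h₁ h₂ h₃ => hmax ⟨h₁, h₂⟩ h₃)
  have h₂ : theoryVal T F = 2 := by
    rw [← heval]
    refine h _ fun G hG => ?_
    rw [heval, theoryVal, if_pos (hXT (.hyp hG))]
  rw [theoryVal, if_neg hFT] at h₂
  split_ifs at h₂ <;> simp at h₂

/-- A sound schema has derivations whose length does not depend on the instance. -/
theorem Entails.exists_costs {X : Set Formula} {F : Formula} (h : Entails X F) :
    ∃ n, ∀ σ, Costs (Formula.subst σ '' X) n {F.subst σ} := by
  obtain ⟨n, m, hm, Y, hY, hF⟩ := h.provable.exists_costs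
  exact ⟨n, fun σ => ⟨m, hm, _, hY.subst σ, by
    simpa using Set.mem_image_of_mem (Formula.subst σ) (hF rfl)⟩⟩

/-! ### Shortcuts in forests -/

/-- The parent function `f` and the depth function `d` make the finite set `V` a forest: the nodes
of depth `0` are the roots, and every other node has its parent one level higher. -/
def IsForest {α : Type*} (V : Finset α) (f : α → α) (d : α → ℕ) : Prop :=
  ∀ v ∈ V, 0 < d v → f v ∈ V ∧ d (f v) + 1 = d v

theorem IsForest.iterate {α : Type*} {V : Finset α} {f : α → α} {d : α → ℕ}
    (h : IsForest V f d) {v : α} (hv : v ∈ V) {j : ℕ} (hj : j ≤ d v) :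
    f^[j] v ∈ V ∧ d (f^[j] v) + j = d v := by
  induction j with
  | zero => simpa using hv
  | succ j ih =>
    obtain ⟨h₁, h₂⟩ := ih (by omega)
    obtain ⟨h₃, h₄⟩ := h _ h₁ (by omega)
    rw [Function.iterate_succ_apply']
    exact ⟨h₃, by omega⟩

/-- The formulas that relate each node of a forest to itself and to its parent. -/
def forestLinks {α : Type*} (E : α → α → Formula) (V : Finset α) (f : α → α) (d : α → ℕ) :
    Set Formula :=
  {F | ∃ v ∈ V, F = E v v ∨ 0 < d v ∧ F = E v (f v)}

/-- The formulas `E u v` compose with `N` derivation steps. -/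
def IsComposable {α : Type*} (E : α → α → Formula) (N : ℕ) : Prop :=
  ∀ u v w, Costs {E u v, E v w} N {E u w}

section Shortcuts

variable {α : Type*} {E : α → α → Formula} {N : ℕ} {V : Finset α} {f : α → α} {d : α → ℕ}

theorem IsComposable.comp (hE : IsComposable E N) {X : Set Formula} {a b : ℕ} {u v w : α}
    (h : Costs X a {E u v}) (h' : Costs X b {E v w}) : Costs X (a + b + N) {E u w} :=
  (h.union h').trans' (by rw [← Set.insert_eq]; exact hE u v w)

theorem IsComposable.comp_mem (hE : IsComposable E N) {X : Set Formula} {u v w : α}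
    (huv : E u v ∈ X) (hvw : E v w ∈ X) : Costs X N {E u w} := by
  simpa using hE.comp (Costs.of_subset (Set.singleton_subset_iff.2 huv))
    (Costs.of_subset (Set.singleton_subset_iff.2 hvw))

/-- Linking each node of `W` to all its ancestors at distance at most `t`. -/
theorem IsForest.costs_ancestors (hV : IsForest V f d) (hE : IsComposable E N) {W : Finset α}
    (hW : W ⊆ V) (t : ℕ) :
    Costs (forestLinks E V f d) (N * W.card * t)
      {F | ∃ v ∈ W, ∃ i ≤ t, i ≤ d v ∧ F = E v (f^[i] v)} := by
  induction t with
  | zero =>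
    apply Costs.of_subset
    rintro _ ⟨v, hv, i, hi, -, rfl⟩
    obtain rfl : i = 0 := by omega
    exact ⟨v, hW hv, .inl rfl⟩
  | succ t ih =>
    have step : Costs (forestLinks E V f d ∪
        {F | ∃ v ∈ W, ∃ i ≤ t, i ≤ d v ∧ F = E v (f^[i] v)}) (N * W.card)
        (⋃ v ∈ W, {F | t + 1 ≤ d v ∧ F = E v (f^[t + 1] v)}) := by
      refine Costs.biUnion W fun v hv => ?_
      by_cases ht : t + 1 ≤ d v
      · obtain ⟨h₁, h₂⟩ := hV.iterate (hW hv) (show t ≤ d v by omega)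
        refine (hE.comp_mem (u := v) (v := f^[t] v) (w := f^[t + 1] v) ?_ ?_).mono
          subset_rfl le_rfl ?_
        · exact .inr ⟨v, hv, t, le_rfl, by omega, rfl⟩
        · exact .inl ⟨_, h₁, .inr ⟨by omega, by rw [Function.iterate_succ_apply']⟩⟩
        · rintro _ ⟨-, rfl⟩
          rfl
      · refine (Costs.of_subset ?_).mono subset_rfl (Nat.zero_le _) subset_rfl
        rintro _ ⟨h, -⟩
        exact absurd h ht
    refine (ih.trans step).mono subset_rfl (by rw [Nat.mul_succ]) ?_
    rintro _ ⟨v, hv, i, hi, hid, rfl⟩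
    rcases Nat.lt_or_ge t i with h | h
    · obtain rfl : i = t + 1 := by omega
      refine .inr ?_
      simp only [Set.mem_iUnion]
      exact ⟨v, hv, hid, rfl⟩
    · exact .inl ⟨v, hv, i, h, hid, rfl⟩

/-- Linking each node to the root of its tree. -/
theorem IsForest.costs_roots (hV : IsForest V f d) (hE : IsComposable E N) :
    Costs (forestLinks E V f d) (N * V.card) {F | ∃ v ∈ V, F = E v (f^[d v] v)} := by
  classical
  -- Level by level, a node's link to its parent is composed with the parent's link to the root, so
  -- each node costs one composition.
  have key : ∀ t, Costs (forestLinks E V f d) (N * (V.filter (d · ≤ t)).card)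
      {F | ∃ v ∈ V, d v ≤ t ∧ F = E v (f^[d v] v)} := by
    intro t
    induction t with
    | zero =>
      refine (Costs.of_subset ?_).mono subset_rfl (Nat.zero_le _) subset_rfl
      rintro _ ⟨v, hv, h, rfl⟩
      rw [Nat.le_zero.1 h]
      exact ⟨v, hv, .inl rfl⟩
    | succ t ih =>
      have step : Costs (forestLinks E V f d ∪
          {F | ∃ v ∈ V, d v ≤ t ∧ F = E v (f^[d v] v)}) (N * (V.filter (d · = t + 1)).card)
          (⋃ v ∈ V.filter (d · = t + 1), {E v (f^[d v] v)}) := by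
        refine Costs.biUnion _ fun v hv => ?_
        rw [Finset.mem_filter] at hv
        obtain ⟨h₁, h₂⟩ := hV v hv.1 (by omega)
        refine hE.comp_mem (v := f v) ?_ ?_
        · exact .inl ⟨v, hv.1, .inr ⟨by omega, rfl⟩⟩
        · exact .inr ⟨_, h₁, by omega, by rw [← h₂, Function.iterate_succ_apply]⟩
      refine (ih.trans step).mono subset_rfl (le_of_eq ?_) ?_
      · rw [← Nat.mul_add, ← Finset.card_union_of_disjoint]
        · congr 2
          ext v
          simp only [Finset.mem_union, Finset.mem_filter, Nat.le_succ_iff, Nat.succ_eq_add_one]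
          tauto
        · refine Finset.disjoint_filter.2 fun v _ h => ?_
          omega
      · rintro _ ⟨v, hv, h, rfl⟩
        rcases Nat.le_succ_iff.1 h with h | h
        · exact .inl ⟨v, hv, h, rfl⟩
        · refine .inr ?_
          simp only [Set.mem_iUnion, Finset.mem_filter]
          exact ⟨v, ⟨hv, h⟩, rfl⟩
  refine (key (V.sup d)).mono subset_rfl
    (Nat.mul_le_mul_left _ (Finset.card_le_card (Finset.filter_subset _ _))) ?_
  rintro _ ⟨v, hv, rfl⟩
  exact ⟨v, hv, Finset.le_sup hv, rfl⟩

end Shortcuts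

theorem ackermann_succ_pos (k m : ℕ) : 0 < ackermann (k + 1) m :=
  (Nat.zero_le m).trans_lt (lt_ackermann_succ k m)

/-- The least frequent residue class of a function modulo `s`. -/
theorem exists_card_filter_mod_mul_le {α : Type*} (V : Finset α) (d : α → ℕ) {s : ℕ}
    (hs : 0 < s) : ∃ r < s, (V.filter (d · % s = r)).card * s ≤ V.card := by
  by_contra! hc
  have h₁ : V.card = ∑ r ∈ Finset.range s, (V.filter (d · % s = r)).card :=
    Finset.card_eq_sum_card_fiberwise fun v _ => by simpa using Nat.mod_lt _ hs
  have h₂ : ∑ _r ∈ Finset.range s, V.card <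
      ∑ r ∈ Finset.range s, (V.filter (d · % s = r)).card * s :=
    Finset.sum_lt_sum_of_nonempty (by simpa using hs.ne')
      fun r hr => hc r (Finset.mem_range.1 hr)
  rw [← Finset.sum_mul, ← h₁] at h₂
  simp [mul_comm] at h₂

/-- In a forest of depth less than `ackermann k m`, a number of shortcuts that is linear in `m`
and in the number of nodes suffices to reach each ancestor of a node in `O(k)` hops. -/
theorem exists_shortcuts {α : Type*} {E : α → α → Formula} {N : ℕ} (hE : IsComposable E N)
    (k : ℕ) : ∀ (m : ℕ) (V : Finset α) (f : α → α) (d : α → ℕ), IsForest V f d →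
    (∀ v ∈ V, d v < ackermann k m) →
    ∃ Y, Costs (forestLinks E V f d) (2 * N * (k + 1) * V.card * m) Y ∧
      ∀ v ∈ V, ∀ j ≤ d v, Costs Y (2 * N * k) {E v (f^[j] v)} := by
  induction k with
  | zero =>
    intro m V f d hV hd
    -- The depth is below `2 * m`, so all ancestors can be linked directly.
    refine ⟨_, (hV.costs_ancestors hE subset_rfl (2 * m)).mono subset_rfl (le_of_eq (by ring))
      subset_rfl, fun v hv j hj => (Costs.of_subset ?_).mono subset_rfl (Nat.zero_le _) subset_rfl⟩
    have := hd v hv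
    rw [ackermann] at this
    rw [Set.singleton_subset_iff]
    exact ⟨v, hv, j, by omega, hj, rfl⟩
  | succ k ihk =>
    intro m
    induction m with
    | zero =>
      intro V f d hV hd
      -- The depth is below `1`: every node is a root and its only ancestor is itself.
      refine ⟨_, (Costs.of_subset subset_rfl).mono subset_rfl (Nat.zero_le _) subset_rfl,
        fun v hv j hj => (Costs.of_subset ?_).mono subset_rfl (Nat.zero_le _) subset_rfl⟩
      have := hd v hv
      rw [ackermann] at this
      obtain rfl : j = 0 := by omega
      rw [Set.singleton_subset_iff]
      exact ⟨v, hv, .inl rfl⟩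
    | succ m ihm =>
      intro V f d hV hd
      have hs := ackermann_succ_pos k m
      rw [ackermann] at hd
      generalize ackermann (k + 1) m = s at *
      -- The forest is cut at every `s`-th level. The offset `r` is chosen so that the cut nodes
      -- number at most `V.card / s`, which pays for work proportional to `s` at each of them.
      obtain ⟨r, hr, hcard⟩ := exists_card_filter_mod_mul_le V d hs
      set W := V.filter (d · % s = r)
      have hWV : W ⊆ V := Finset.filter_subset _ _
      have hWmem : ∀ w, w ∈ W ↔ w ∈ V ∧ d w % s = r := fun w => Finset.mem_filter
      -- the forest of the nodes whose depth is `r` modulo `s`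
      have hW : IsForest W f^[s] fun v => d v / s := by
        intro v hv hpos
        obtain ⟨hv, hmod⟩ := (hWmem v).1 hv
        have hle : s ≤ d v := (Nat.div_pos_iff.1 hpos).2
        obtain ⟨h₁, h₂⟩ := hV.iterate hv hle
        rw [← h₂, Nat.add_mod_right] at hmod
        exact ⟨(hWmem _).2 ⟨h₁, hmod⟩, by simp only [← h₂, Nat.add_div_right _ hs]⟩
      -- the forest that remains when the nodes of `W` become roots
      set d' : α → ℕ := fun v => if d v < r then d v else (d v - r) % s with hd'
      have hmod : ∀ a, 0 < (a + 1) % s → (a + 1) % s = a % s + 1 := by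
        intro a ha
        rw [Nat.add_mod] at ha ⊢
        have := Nat.mod_lt a hs
        rcases Nat.lt_or_ge 1 s with h1 | h1
        · rw [Nat.mod_eq_of_lt h1] at ha ⊢
          rcases Nat.lt_or_ge (a % s + 1) s with h | h
          · exact Nat.mod_eq_of_lt h
          · rw [show a % s + 1 = s by omega, Nat.mod_self] at ha
            omega
        · obtain rfl : s = 1 := by omega
          simp [Nat.mod_one] at ha
      have hV' : IsForest V f d' := by
        intro v hv hpos
        have hpos' : 0 < d v := by
          by_contra h0
          simp [hd', show d v = 0 by omega] at hpos
        obtain ⟨h₁, h₂⟩ := hV v hv hpos'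
        refine ⟨h₁, ?_⟩
        simp only [hd'] at hpos ⊢
        rcases Nat.lt_trichotomy (d v) r with h | h | h
        · rw [if_pos h, if_pos (by omega)]
          exact h₂
        · simp [h] at hpos
        · rw [if_neg (by omega)] at hpos
          rw [if_neg (by omega), if_neg (by omega)]
          rw [show d v - r = d (f v) - r + 1 by omega] at hpos ⊢
          exact (hmod _ hpos).symm
      have hd'le : ∀ v, d' v ≤ d v := by
        intro v
        simp only [hd']
        split_ifs
        · exact le_rfl
        · exact (Nat.mod_le _ _).trans (Nat.sub_le _ _)
      have hlinks : forestLinks E V f d' ⊆ forestLinks E V f d := by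
        rintro F ⟨v, hv, h | ⟨hpos, h⟩⟩
        · exact ⟨v, hv, .inl h⟩
        · exact ⟨v, hv, .inr ⟨hpos.trans_le (hd'le v), h⟩⟩
      -- The contracted forest on `W` is handled at level `k` with parameter `s`, since its depths
      -- are below `ackermann k s`. The pieces between cuts have depth below `s` and are handled at
      -- level `k + 1` with parameter `m`.
      obtain ⟨Y₁, hY₁, hq₁⟩ := ihk s W f^[s] _ hW fun v hv =>
        (Nat.div_le_self _ _).trans_lt (hd v (hWV hv))
      obtain ⟨Y₂, hY₂, hq₂⟩ := ihm V f d' hV' fun v _ => by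
        simp only [hd']
        split_ifs
        · omega
        · exact Nat.mod_lt _ hs
      have hroots := (hV'.costs_roots hE).mono hlinks le_rfl subset_rfl
      have hanc := hV.costs_ancestors hE hWV s
      set R := {F | ∃ v ∈ V, F = E v (f^[d' v] v)}
      set S := {F | ∃ v ∈ W, ∃ i ≤ s, i ≤ d v ∧ F = E v (f^[i] v)}
      have hWlinks : forestLinks E W f^[s] (fun v => d v / s) ⊆ S := by
        rintro F ⟨v, hv, h | ⟨hpos, h⟩⟩
        · exact ⟨v, hv, 0, Nat.zero_le _, Nat.zero_le _, h⟩
        · exact ⟨v, hv, s, le_rfl, (Nat.div_pos_iff.1 hpos).2, h⟩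
      have hall := ((hanc.trans (hY₁.mono (hWlinks.trans Set.subset_union_right) le_rfl
        subset_rfl)).union hroots).union (hY₂.mono hlinks le_rfl subset_rfl)
      refine ⟨_, hall.mono subset_rfl ?_ subset_rfl, fun v hv j hj => ?_⟩
      · have h₁ : N * W.card * s ≤ N * V.card := by
          rw [mul_assoc]
          exact Nat.mul_le_mul_left _ hcard
        have h₂ : 2 * N * (k + 1) * W.card * s ≤ 2 * N * (k + 1) * V.card := by
          rw [mul_assoc]
          exact Nat.mul_le_mul_left _ hcard
        -- Ancestor links, shortcuts on `W` and root links add up to at most `2 * N * (k + 2) *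
        -- V.card`, which is the increment of the bound from `m` to `m + 1`.
        calc _ ≤ N * V.card + 2 * N * (k + 1) * V.card + N * V.card +
              2 * N * (k + 1 + 1) * V.card * m := by omega
          _ = _ := by ring
      -- An ancestor beyond the piece of `v` is reached from `v` to the root `w` of its piece, then
      -- inside `W` to a node less than `s` levels below the target, then by a direct link. The two
      -- extra compositions raise `2 * N * k` to `2 * N * (k + 1)`.
      · rcases Nat.lt_or_ge (d' v) j with hlt | hge
        · have hvr : ¬ d v < r := by
            intro h
            simp only [hd', if_pos h] at hlt
            omega
          have hd'v : d' v = (d v - r) % s := by simp only [hd', if_neg hvr]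
          obtain ⟨hwV, hdw⟩ := hV.iterate hv (hd'le v)
          have hwdepth : d (f^[d' v] v) = s * ((d v - r) / s) + r := by
            have := Nat.div_add_mod (d v - r) s
            omega
          have hwmod : d (f^[d' v] v) % s = r := by
            rw [hwdepth, Nat.mul_add_mod, Nat.mod_eq_of_lt hr]
          have hwdiv : d (f^[d' v] v) / s = (d v - r) / s := by
            rw [hwdepth, Nat.mul_add_div hs, Nat.div_eq_of_lt hr, add_zero]
          generalize (d v - r) / s = q at *
          set w := f^[d' v] v with hw
          have hwW : w ∈ W := (hWmem w).2 ⟨hwV, hwmod⟩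
          obtain ⟨i, hi⟩ : ∃ i, j = d' v + i := ⟨j - d' v, by omega⟩
          have hiw : i ≤ d w := by omega
          have hp : i / s ≤ d w / s := Nat.div_le_div_right hiw
          have hmid := hq₁ w hwW (i / s) hp
          have hw'W := (hW.iterate hwW hp).1
          rw [← Function.iterate_mul] at hmid hw'W
          have hi' := Nat.div_add_mod i s
          obtain ⟨-, hdw'⟩ := hV.iterate hwV (show s * (i / s) ≤ d w by omega)
          have hsmod := Nat.mod_lt i hs
          have hlast : E (f^[s * (i / s)] w) (f^[j] v) ∈ S := by
            refine ⟨_, hw'W, i % s, hsmod.le, by omega, ?_⟩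
            simp only [hw, ← Function.iterate_add_apply]
            congr 2
            omega
          have hfirst : E v w ∈ R := ⟨v, hv, rfl⟩
          have hc := hE.comp (X := S ∪ Y₁ ∪ R ∪ Y₂) (a := 0)
            (Costs.of_subset (Set.singleton_subset_iff.2 (.inl (.inr hfirst))))
            (hE.comp (b := 0) (hmid.mono (fun x hx => .inl (.inl (.inr hx))) le_rfl subset_rfl)
              (Costs.of_subset (Set.singleton_subset_iff.2 (.inl (.inl (.inl hlast))))))
          exact hc.mono subset_rfl (le_of_eq (by ring)) subset_rfl
        · exact (hq₂ v hv j hge).mono Set.subset_union_right le_rfl subset_rfl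

/-! ### Growth of the Ackermann function -/

theorem ackermann_strictMono (k : ℕ) : StrictMono (ackermann k) := by
  induction k with
  | zero => exact fun a b h => by simp only [ackermann]; omega
  | succ k ih =>
    refine strictMono_nat_of_lt_succ fun m => ?_
    rw [ackermann]
    cases k with
    | zero =>
      have := ackermann_succ_pos 0 m
      simp only [ackermann]
      omega
    | succ k => exact lt_ackermann_succ k _

theorem ackermann_two (k : ℕ) : ackermann k 2 = 4 := by
  have h₁ : ∀ k, ackermann k 1 = 2 := by
    intro k
    induction k with
    | zero => rw [ackermann]
    | succ k ih => rw [ackermann, ackermann, ih]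
  induction k with
  | zero => rw [ackermann]
  | succ k ih => rw [ackermann, h₁, ih]

theorem le_ackermann_three (k : ℕ) : k ≤ ackermann k 3 := by
  induction k with
  | zero => exact Nat.zero_le _
  | succ k ih =>
    rw [ackermann, ackermann_two]
    have := ackermann_strictMono k (show 3 < 4 by norm_num)
    omega

/-- The diagonal is dominated with the second argument fixed at `4`. The parameter `m` of
`exists_shortcuts` can thus be constant, and only `k` grows with the proof. -/
theorem ackermann_self_le (k : ℕ) : ackermann k k ≤ ackermann (k + 1) 4 := by
  rw [ackermann]
  exact (ackermann_strictMono k).monotone ((Nat.le_succ k).trans (le_ackermann_three (k + 1)))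

theorem lt_ackermann_invAckermann (n : ℕ) : n < ackermann (invAckermann n + 1) 4 :=
  (Nat.find_spec (exists_lt_ackermann n)).trans_le (ackermann_self_le _)

theorem invAckermann_pos (n : ℕ) : 0 < invAckermann n := by
  rw [invAckermann, Nat.find_pos]
  simp [ackermann]

/-! ### Schemas used in the translation -/

/-- The implication for which HŁuk has the deduction theorem: `F` holds whenever `G` does. -/
def Formula.under (G F : Formula) : Formula := G.imp (G.imp F)

/-- The rules of natural deduction without discharge, as schemas in two variables. -/
def ndRules : List (List Formula × Formula) :=
  let p := Formula.var 1
  let q := Formula.var 2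
  [([], (p.or p.not).or ((q.or q.not).or (p.imp q))),
    ([p, p.not], q),
    ([p, q], p.and q),
    ([p.and q], p),
    ([p.and q], q),
    ([p], p.or q),
    ([q], p.or q),
    ([p], p.not.not),
    ([p.not.not], p),
    ([(p.or q).not], p.not.and q.not),
    ([p.not.and q.not], (p.or q).not),
    ([(p.and q).not], p.not.or q.not),
    ([p.not.or q.not], (p.and q).not),
    ([p.not.and q.not], p.imp q),
    ([p.not], (q.or q.not).or (p.imp q)),
    ([p.not.and q], p.imp q),
    ([q.not, (p.imp q).or (p.imp q).not], p.or p.not),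
    ([q], (p.or p.not).or (p.imp q)),
    ([p.and q.not], (p.imp q).not),
    ([p, (p.imp q).or (p.imp q).not], q.or q.not),
    ([p.and q], p.imp q)]

/-- Schemas that handle contexts; the variable `0` stands for the conjunction of a context. -/
def contextRules : List (List Formula × Formula) :=
  let g := Formula.var 0
  let p := Formula.var 1
  let q := Formula.var 2
  let r := Formula.var 3
  [([], g.imp g),
    ([], (p.and g).imp g),
    ([g.imp p, p.imp q], g.imp q),
    ([g.imp (p.and q)], g.under p),
    ([g.under (p.or q), (p.and g).under r, (q.and g).under r], g.under r),
    ([(g.imp g).under p], p)]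

/-- If `G` is not designated, then `G ⊃ F` has value at least `1`, and a second implication from `G`
lifts this to `2`. -/
theorem eval_under (v : ℕ → Fin 3) (G F : Formula) :
    (G.under F).eval v = if G.eval v = 2 then F.eval v else 2 := by
  simp only [Formula.under, Formula.eval]
  generalize G.eval v = a
  generalize F.eval v = b
  revert a b
  decide

/-- A consequence remains one in every context. -/
theorem Entails.under {Ps : List Formula} {F : Formula} (h : Entails {P | P ∈ Ps} F)
    (G : Formula) : Entails {P | P ∈ Ps.map G.under} (G.under F) := by
  intro v hv
  rw [eval_under]
  split_ifs with hG
  · refine h v fun P hP => ?_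
    have := hv (G.under P) (List.mem_map_of_mem hP)
    rwa [eval_under, if_pos hG] at this
  · rfl

theorem entails_ndRules : ∀ r ∈ ndRules, Entails {P | P ∈ r.1} r.2 := by
  simp only [ndRules, List.forall_mem_cons, List.not_mem_nil, false_imp_iff,
    implies_true, and_true]
  refine ⟨?_, ?_, ?_, ?_, ?_, ?_, ?_, ?_, ?_, ?_, ?_, ?_, ?_, ?_, ?_, ?_, ?_, ?_, ?_, ?_, ?_⟩
  all_goals
    intro v hv
    simp only [Set.mem_ofPred_eq, List.forall_mem_cons, List.not_mem_nil, false_imp_iff,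
      implies_true, and_true, Formula.eval] at hv ⊢
    revert hv
    generalize v 1 = a
    generalize v 2 = b
    revert a b
    decide

theorem entails_contextRules : ∀ r ∈ contextRules, Entails {P | P ∈ r.1} r.2 := by
  simp only [contextRules, List.forall_mem_cons, List.not_mem_nil, false_imp_iff,
    implies_true, and_true]
  refine ⟨?_, ?_, ?_, ?_, ?_, ?_⟩
  all_goals
    intro v hv
    simp only [Set.mem_ofPred_eq, List.forall_mem_cons, List.not_mem_nil, false_imp_iff,
      implies_true, and_true, Formula.eval, Formula.under] at hv ⊢
    revert hv
    generalize v 0 = a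
    generalize v 1 = b
    generalize v 2 = c
    generalize v 3 = e
    revert a b c e
    decide

/-- The substitution of four formulas for the variables `0`, `1`, `2` and `3`. -/
def substOf (G A B C : Formula) : ℕ → Formula
  | 0 => G
  | 1 => A
  | 2 => B
  | _ => C

/-- All instances of the schemas in a list have derivations with at most `N` steps. -/
def IsBoundFor (N : ℕ) (L : List (List Formula × Formula)) : Prop :=
  ∀ r ∈ L, ∀ G A B C : Formula, Costs {P | P ∈ r.1.map (Formula.subst (substOf G A B C))} N
    {r.2.subst (substOf G A B C)}

theorem exists_isBoundFor (L : List (List Formula × Formula))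
    (h : ∀ r ∈ L, Entails {P | P ∈ r.1} r.2) : ∃ N, IsBoundFor N L := by
  induction L with
  | nil => exact ⟨0, by simp [IsBoundFor]⟩
  | cons r L ih =>
    rw [List.forall_mem_cons] at h
    obtain ⟨N, hN⟩ := ih h.2
    obtain ⟨M, hM⟩ := h.1.exists_costs
    refine ⟨M + N, List.forall_mem_cons.2 ⟨fun G A B C => ?_, fun r hr G A B C => ?_⟩⟩
    · refine (hM (substOf G A B C)).mono ?_ (Nat.le_add_right _ _) subset_rfl
      rintro _ ⟨P, hP, rfl⟩
      exact List.mem_map_of_mem hP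
    · exact (hN r hr G A B C).mono subset_rfl (Nat.le_add_left _ _) subset_rfl

/-- The schemas of `ndRules` in a context, together with `contextRules`. -/
def sequentRules : List (List Formula × Formula) :=
  contextRules ++ ndRules.map fun r => (r.1.map (Formula.var 0).under, (Formula.var 0).under r.2)

theorem exists_isBoundFor_sequentRules : ∃ N, IsBoundFor N sequentRules := by
  refine exists_isBoundFor _ fun r hr => ?_
  rcases List.mem_append.1 hr with hr | hr
  · exact entails_contextRules r hr
  · obtain ⟨r', hr', rfl⟩ := List.mem_map.1 hr
    exact (entails_ndRules r' hr').under _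

/-! ### Translation of natural deduction -/

/-- The conjunction of the assumptions in a context. -/
def conj : List Formula → Formula
  | [] => (Formula.var 0).imp (Formula.var 0)
  | A :: Γ => A.and (conj Γ)

/-- The formula that says that the context `Γ` implies the context `Δ`. -/
def conjImp (Γ Δ : List Formula) : Formula := (conj Γ).imp (conj Δ)

/-- `A` can be derived in the context `Γ` with a number of steps that is linear in `n`, once the
implications between certain extensions of `Γ`, at most `n` in number, and their own tails are
available, at the price of `h` steps each. -/
def Translates (N : ℕ) (Γ : List Formula) (A : Formula) (n : ℕ) : Prop :=
  ∃ V : Finset (List Formula), Γ ∈ V ∧ V.card ≤ n ∧ (∀ v ∈ V, v.length < Γ.length + n) ∧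
    (∀ v ∈ V, v = Γ ∨ 0 < v.length ∧ v.tail ∈ V) ∧
    ∀ (Y : Set Formula) (h : ℕ),
      (∀ v ∈ V, ∀ j ≤ v.length, Costs Y h {conjImp v (List.tail^[j] v)}) →
      Costs Y ((h + N) * n) {(conj Γ).under A}

namespace Translates

variable {N n m k : ℕ} {Γ : List Formula} {A B C : Formula}

theorem zero (h : Costs {P | P ∈ ([] : List Formula)} N {(conj Γ).under A}) :
    Translates N Γ A 1 := by
  refine ⟨{Γ}, by simp, by simp, by simp, by simp, fun Y h' _ => ?_⟩
  exact h.mono (by simp) (by omega) subset_rfl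

theorem one (hA : Translates N Γ A n)
    (h : Costs {P | P ∈ [(conj Γ).under A]} N {(conj Γ).under B}) :
    Translates N Γ B (n + 1) := by
  obtain ⟨V, h₁, h₂, h₃, h₄, h₅⟩ := hA
  refine ⟨V, h₁, by omega, fun v hv => (h₃ v hv).trans (by omega), h₄, fun Y c hY => ?_⟩
  refine ((h₅ Y c hY).trans' (h.mono (by simp) le_rfl subset_rfl)).mono subset_rfl ?_ subset_rfl
  rw [Nat.mul_succ]
  omega

theorem two (hA : Translates N Γ A n) (hB : Translates N Γ B m)
    (h : Costs {P | P ∈ [(conj Γ).under A, (conj Γ).under B]} N {(conj Γ).under C}) :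
    Translates N Γ C (n + m + 1) := by
  classical
  obtain ⟨V, h₁, h₂, h₃, h₄, h₅⟩ := hA
  obtain ⟨W, -, g₂, g₃, g₄, g₅⟩ := hB
  refine ⟨V ∪ W, Finset.mem_union_left _ h₁, (Finset.card_union_le _ _).trans (by omega),
    fun v hv => ?_, fun v hv => ?_, fun Y c hY => ?_⟩
  · rcases Finset.mem_union.1 hv with hv | hv
    · exact (h₃ v hv).trans (by omega)
    · exact (g₃ v hv).trans (by omega)
  · rcases Finset.mem_union.1 hv with hv | hv
    · exact (h₄ v hv).imp_right fun h => ⟨h.1, Finset.mem_union_left _ h.2⟩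
    · exact (g₄ v hv).imp_right fun h => ⟨h.1, Finset.mem_union_right _ h.2⟩
  · have hV := h₅ Y c fun v hv => hY v (Finset.mem_union_left _ hv)
    have hW := g₅ Y c fun v hv => hY v (Finset.mem_union_right _ hv)
    refine ((hV.union hW).trans' (h.mono (fun P hP => ?_) le_rfl subset_rfl)).mono subset_rfl ?_
      subset_rfl
    · rcases List.mem_pair.1 hP with h | h
      · exact .inl h
      · exact .inr h
    · rw [Nat.mul_succ, Nat.mul_add]
      omega

/-- The context sets of the side derivations are rooted at `A :: Γ` and `B :: Γ`. They are attached
to the first one at `Γ`, the tail of both. -/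
theorem orElim (hAB : Translates N Γ (A.or B) n) (hA : Translates N (A :: Γ) C m)
    (hB : Translates N (B :: Γ) C k)
    (h : Costs {P | P ∈ [(conj Γ).under (A.or B), (conj (A :: Γ)).under C,
      (conj (B :: Γ)).under C]} N {(conj Γ).under C}) :
    Translates N Γ C (n + m + k + 1) := by
  classical
  obtain ⟨V, h₁, h₂, h₃, h₄, h₅⟩ := hAB
  obtain ⟨W, -, g₂, g₃, g₄, g₅⟩ := hA
  obtain ⟨U, -, f₂, f₃, f₄, f₅⟩ := hB
  refine ⟨V ∪ W ∪ U, by simp [h₁], ?_, fun v hv => ?_, fun v hv => ?_, fun Y c hY => ?_⟩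
  · have := Finset.card_union_le (V ∪ W) U
    have := Finset.card_union_le V W
    omega
  · simp only [List.length_cons] at g₃ f₃
    rcases Finset.mem_union.1 hv with hv | hv
    · rcases Finset.mem_union.1 hv with hv | hv
      · exact (h₃ v hv).trans_le (by omega)
      · exact (g₃ v hv).trans_le (by omega)
    · exact (f₃ v hv).trans_le (by omega)
  · simp only [Finset.mem_union] at hv ⊢
    rcases hv with (hv | hv) | hv
    · exact (h₄ v hv).imp_right fun h => ⟨h.1, .inl (.inl h.2)⟩
    · rcases g₄ v hv with rfl | h
      · exact .inr ⟨by simp, .inl (.inl h₁)⟩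
      · exact .inr ⟨h.1, .inl (.inr h.2)⟩
    · rcases f₄ v hv with rfl | h
      · exact .inr ⟨by simp, .inl (.inl h₁)⟩
      · exact .inr ⟨h.1, .inr h.2⟩
  · have hV := h₅ Y c fun v hv => hY v (by simp [hv])
    have hW := g₅ Y c fun v hv => hY v (by simp [hv])
    have hU := f₅ Y c fun v hv => hY v (by simp [hv])
    refine (((hV.union hW).union hU).trans' (h.mono (fun P hP => ?_) le_rfl subset_rfl)).mono
      subset_rfl ?_ subset_rfl
    · simp only [Set.mem_ofPred_eq, List.mem_cons, List.not_mem_nil, or_false] at hP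
      exact or_assoc.2 hP
    · rw [Nat.mul_succ, Nat.mul_add, Nat.mul_add]
      omega

/-- Only here is the price `h` of an ancestor query paid: some iterated tail of `Γ` begins with `A`,
and one implication leads to its conjunction. -/
theorem assumption (hA : A ∈ Γ)
    (h : ∀ Δ, Costs {P | P ∈ [conjImp Γ (A :: Δ)]} N {(conj Γ).under A}) :
    Translates N Γ A 1 := by
  refine ⟨{Γ}, by simp, by simp, by simp, by simp, fun Y c hY => ?_⟩
  have key : ∀ Γ : List Formula, A ∈ Γ → ∃ j ≤ Γ.length, ∃ Δ, List.tail^[j] Γ = A :: Δ := by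
    intro Γ hA
    induction Γ with
    | nil => simp at hA
    | cons B Γ ih =>
      rcases List.mem_cons.1 hA with rfl | hA
      · exact ⟨0, Nat.zero_le _, Γ, rfl⟩
      · obtain ⟨j, hj, Δ, hΔ⟩ := ih hA
        exact ⟨j + 1, by simpa using hj, Δ, hΔ⟩
  obtain ⟨j, hj, Δ, hΔ⟩ := key Γ hA
  have := hY Γ (by simp) j hj
  rw [hΔ] at this
  simpa using this.trans' ((h Δ).mono (by simp) le_rfl subset_rfl)

end Translates

/-- Labels are forgotten: a context need only contain the formulas of the open assumptions, so a
discharge amounts to pushing a disjunct onto the list. -/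
theorem NDTree.translates {N : ℕ} (hN : IsBoundFor N sequentRules) {A : Formula} (D : NDTree A) :
    ∀ Γ : List Formula, (∀ a ∈ D.openAssumptions, a.2 ∈ Γ) → Translates N Γ A D.steps := by
  -- Indices `0` to `5` point into `contextRules`, and index `i + 6` to entry `i` of `ndRules`.
  -- Schema variables that do not occur receive arbitrary formulas.
  have use : ∀ {r} (i : ℕ), sequentRules[i]? = some r → ∀ G A B C : Formula,
      Costs {P | P ∈ r.1.map (Formula.subst (substOf G A B C))} N
        {r.2.subst (substOf G A B C)} :=
    fun i h => hN _ (List.mem_of_getElem? h)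
  induction D with
  | assume u A =>
    intro Γ hΓ
    exact .assumption (hΓ (u, A) rfl) fun Δ => use 3 rfl (conj Γ) A (conj Δ) A
  | ax A B => exact fun Γ _ => .zero (use 6 rfl (conj Γ) A B B)
  | @efq A B _ _ ih₁ ih₂ =>
    exact fun Γ hΓ => (ih₁ Γ fun a ha => hΓ a (.inl ha)).two (ih₂ Γ fun a ha => hΓ a (.inr ha))
      (use 7 rfl (conj Γ) A B B)
  | @andI A B _ _ ih₁ ih₂ =>
    exact fun Γ hΓ => (ih₁ Γ fun a ha => hΓ a (.inl ha)).two (ih₂ Γ fun a ha => hΓ a (.inr ha))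
      (use 8 rfl (conj Γ) A B B)
  | @andE1 A B _ ih => exact fun Γ hΓ => (ih Γ hΓ).one (use 9 rfl (conj Γ) A B B)
  | @andE2 A B _ ih => exact fun Γ hΓ => (ih Γ hΓ).one (use 10 rfl (conj Γ) A B B)
  | @orI1 A B _ ih => exact fun Γ hΓ => (ih Γ hΓ).one (use 11 rfl (conj Γ) A B B)
  | @orI2 A B _ ih => exact fun Γ hΓ => (ih Γ hΓ).one (use 12 rfl (conj Γ) A B B)
  | @orE u v A B C _ _ _ ih₁ ih₂ ih₃ =>
    intro Γ hΓ
    have h₂ : ∀ a ∈ NDTree.openAssumptions _, a.2 ∈ A :: Γ := fun a ha => by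
      by_cases h : a = (u, A)
      · simp [h]
      · exact List.mem_cons_of_mem _ (hΓ a (.inl (.inr ⟨ha, h⟩)))
    have h₃ : ∀ a ∈ NDTree.openAssumptions _, a.2 ∈ B :: Γ := fun a ha => by
      by_cases h : a = (v, B)
      · simp [h]
      · exact List.mem_cons_of_mem _ (hΓ a (.inr ⟨ha, h⟩))
    exact (ih₁ Γ fun a ha => hΓ a (.inl (.inl ha))).orElim (ih₂ _ h₂) (ih₃ _ h₃)
      (use 4 rfl (conj Γ) A B C)
  | @dnI A _ ih => exact fun Γ hΓ => (ih Γ hΓ).one (use 13 rfl (conj Γ) A A A)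
  | @dnE A _ ih => exact fun Γ hΓ => (ih Γ hΓ).one (use 14 rfl (conj Γ) A A A)
  | @deMOr A B _ ih => exact fun Γ hΓ => (ih Γ hΓ).one (use 15 rfl (conj Γ) A B B)
  | @deMOrInv A B _ ih => exact fun Γ hΓ => (ih Γ hΓ).one (use 16 rfl (conj Γ) A B B)
  | @deMAnd A B _ ih => exact fun Γ hΓ => (ih Γ hΓ).one (use 17 rfl (conj Γ) A B B)
  | @deMAndInv A B _ ih => exact fun Γ hΓ => (ih Γ hΓ).one (use 18 rfl (conj Γ) A B B)
  | @imp1 A B _ ih => exact fun Γ hΓ => (ih Γ hΓ).one (use 19 rfl (conj Γ) A B B)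
  | @imp2 A B _ ih => exact fun Γ hΓ => (ih Γ hΓ).one (use 20 rfl (conj Γ) A B B)
  | @imp3 A B _ ih => exact fun Γ hΓ => (ih Γ hΓ).one (use 21 rfl (conj Γ) A B B)
  | @imp4 A B _ _ ih₁ ih₂ =>
    exact fun Γ hΓ => (ih₁ Γ fun a ha => hΓ a (.inl ha)).two (ih₂ Γ fun a ha => hΓ a (.inr ha))
      (use 22 rfl (conj Γ) A B B)
  | @imp5 A B _ ih => exact fun Γ hΓ => (ih Γ hΓ).one (use 23 rfl (conj Γ) A B B)
  | @imp6 A B _ ih => exact fun Γ hΓ => (ih Γ hΓ).one (use 24 rfl (conj Γ) A B B)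
  | @imp7 A B _ _ ih₁ ih₂ =>
    exact fun Γ hΓ => (ih₁ Γ fun a ha => hΓ a (.inl ha)).two (ih₂ Γ fun a ha => hΓ a (.inr ha))
      (use 25 rfl (conj Γ) A B B)
  | @imp8 A B _ ih => exact fun Γ hΓ => (ih Γ hΓ).one (use 26 rfl (conj Γ) A B B)

theorem NDTree.steps_pos {A : Formula} (D : NDTree A) : 0 < D.steps := by
  cases D <;> simp [NDTree.steps]

theorem IsBoundFor.isComposable {N : ℕ} (hN : IsBoundFor N sequentRules) :
    IsComposable conjImp N := fun Γ Δ Θ => by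
  refine (hN _ (List.mem_of_getElem? (i := 2) rfl) (conj Γ) (conj Δ) (conj Θ) (conj Γ)).mono
    (fun P hP => ?_) le_rfl subset_rfl
  exact List.mem_pair.1 hP

/-- The links of the forest of contexts are derivable with linearly many steps. -/
theorem IsBoundFor.costs_forestLinks {N : ℕ} (hN : IsBoundFor N sequentRules)
    (V : Finset (List Formula)) :
    Costs ∅ (2 * N * V.card) (forestLinks conjImp V List.tail List.length) := by
  have h : ∀ Γ ∈ V, Costs ∅ (N + N) ({conjImp Γ Γ} ∪ {conjImp Γ Γ.tail}) := fun Γ _ => by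
    have hrefl : Costs ∅ N {conjImp Γ Γ} :=
      (hN _ (List.mem_of_getElem? (i := 0) rfl) (conj Γ) (conj Γ) (conj Γ) (conj Γ)).mono
        (fun P hP => absurd hP List.not_mem_nil) le_rfl subset_rfl
    refine hrefl.union ?_
    cases Γ with
    | nil => exact hrefl
    | cons A Γ =>
      exact (hN _ (List.mem_of_getElem? (i := 1) rfl) (conj Γ) A A A).mono
        (fun P hP => absurd hP List.not_mem_nil) le_rfl subset_rfl
  refine (Costs.biUnion V h).mono subset_rfl (le_of_eq (by ring)) ?_
  rintro _ ⟨Γ, hΓ, rfl | ⟨-, rfl⟩⟩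
  · exact Set.mem_biUnion hΓ (.inl rfl)
  · exact Set.mem_biUnion hΓ (.inr rfl)

end Luk3

/-- Every ND_{Ł3} proof of `A` with `n` steps yields an HŁuk proof of `A` with `O(n · α(n))`
steps; the constant does not depend on `A` or on the proof. -/
theorem mainTheorem5 :
    ∃ c : ℕ, ∀ (A : Luk3.Formula) (D : Luk3.NDTree A), D.IsProof →
      ∃ l : List Luk3.Formula, Luk3.IsHLukProof l A ∧
        l.length ≤ c * (D.steps * Luk3.invAckermann D.steps) := by
  open Luk3 in
  obtain ⟨N, hN⟩ := exists_isBoundFor_sequentRules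
  -- The total is `N * (10 * (n * a) + 21 * n + 1)`, and `32 = 10 + 21 + 1` because `n` and `a` are
  -- positive.
  refine ⟨32 * N, fun A D hD => ?_⟩
  obtain ⟨V, -, hcard, hlen, htail, htrans⟩ := D.translates hN [] (by rw [hD]; simp)
  have hforest : IsForest V List.tail List.length := fun v hv hpos => by
    rcases htail v hv with rfl | h
    · simp at hpos
    · exact ⟨h.2, by rw [List.length_tail]; omega⟩
  have hn := D.steps_pos
  have ha := invAckermann_pos D.steps
  have hdepth := lt_ackermann_invAckermann D.steps
  generalize invAckermann D.steps = a at *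
  generalize D.steps = n at *
  obtain ⟨Y, hY, hquery⟩ := exists_shortcuts hN.isComposable (a + 1) 4 V _ _ hforest
    fun v hv => (hlen v hv).trans (by simpa using hdepth)
  have hfinal : Costs {(conj []).under A} N {A} :=
    (hN _ (List.mem_of_getElem? (i := 5) rfl) (.var 0) A A A).mono
      (fun P hP => List.mem_singleton.1 hP) le_rfl subset_rfl
  have hall := (((hN.costs_forestLinks V).trans' hY).trans' (htrans Y _ hquery)).trans' hfinal
  obtain ⟨l, hl, hle⟩ := hall.exists_proof
  refine ⟨l, hl, hle.trans ?_⟩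
  have hna : n ≤ n * a := Nat.le_mul_of_pos_right n ha
  calc _ ≤ 2 * N * n + 2 * N * (a + 1 + 1) * n * 4 + (2 * N * (a + 1) + N) * n + N := by gcongr
    _ = N * (10 * (n * a) + 21 * n + 1) := by ring
    _ ≤ N * (10 * (n * a) + 21 * (n * a) + n * a) := by gcongr; omega
    _ = _ := by ring
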